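/- Let $G$ be a connected non-bipartite graph on the agents $\{1,\dots,N\}$, let $N_i$ be the degree of agent $i$, and let $\Psi$ be the Metropolis–Hastings transition matrix, $\Psi(i,i')=\min\{1/N_i,1/N_{i'}\}$ for neighbours $i\neq i'$, $\Psi(i,i)=1-\sum_{k\sim i}\Psi(i,k)$, and $\Psi(i,i')=0$ otherwise. Let $\Gamma(\Psi)=1-\max\{|\lambda| : \lambda\neq 1 \text{ an eigenvalue of } \Psi\}$ be its (absolute) spectral gap, which is assumed to be bounded below by a constant $\gamma>0$ that does not depend on $N$. Let $h>0$ be a constant and $g(N)>\ln N$. Dissemination takes place in synchronous slots. At the start each agent puts $K=h\,g(N)$ tokens (rounded to an integer) of length $L$ into its own first-in-first-out queue. In each slot every agent pops the first (up to) $K$ tokens of its queue, decreases the length of each by one, and forwards each of them, independently of all other choices, to a random agent with law $\Psi(i,\cdot)$, where $i$ is the forwarding agent. A received token of non-zero length is appended to the queue of the receiver (tokens arriving in the same slot in any order); a received token of length zero has completed its walk. A message that forwards a token has $M$ bits for the carried vector ($M$ constant), the binary digits of the token's length, and $O(\log N)$ further bits of protocol information. There is a constant $A>0$, depending only on $\gamma$,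 such that for all walk lengths $L$ with $A\ln N\le L\le B\ln N$, $B$ a constant, the following holds with constants that depend only on $\gamma,h,B,M$ and the constant in the header size (not on $N$, $G$ or $g$). 1. The endpoint of every walk, i.e. its position after $L$ steps, is $1/N^3$-nearly uniform: every agent is the endpoint with probability in $\left[\frac1N-\frac1{N^3},\frac1N+\frac1{N^3}\right]$. 2. With probability at least $1-N^{-h/3}$, all walks of all agents complete their $L$ steps (and hence reach these endpoints) within $\Delta=O(\log^2 N)$ slots. 3. In these $\Delta$ slots, which form one round, each agent sends $O(g(N)\log^3 N)$ bits. -/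

import Mathlib

open MeasureTheory

noncomputable section

namespace MHRW

/-- Transition matrix of the Metropolis-Hastings random walk on `G`. -/
def transition {N : ℕ} (G : SimpleGraph (Fin N)) [DecidableRel G.Adj] :
    Matrix (Fin N) (Fin N) ℝ := fun i j =>
  if i = j then
    1 - ∑ k ∈ G.neighborFinset i, min (1 / (G.degree i : ℝ)) (1 / (G.degree k : ℝ))
  else if G.Adj i j then min (1 / (G.degree i : ℝ)) (1 / (G.degree j : ℝ))
  else 0

theorem transition_nonneg {N : ℕ} (G : SimpleGraph (Fin N)) [DecidableRel G.Adj]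
    (i j : Fin N) : 0 ≤ transition G i j := by
  unfold transition
  split_ifs
  · have h1 : ∑ k ∈ G.neighborFinset i, min (1 / (G.degree i : ℝ)) (1 / (G.degree k : ℝ))
        ≤ ∑ _k ∈ G.neighborFinset i, 1 / (G.degree i : ℝ) :=
      Finset.sum_le_sum fun k _ => min_le_left _ _
    have h2 : ∑ _k ∈ G.neighborFinset i, 1 / (G.degree i : ℝ) ≤ 1 := by
      rw [Finset.sum_const, SimpleGraph.card_neighborFinset_eq_degree, nsmul_eq_mul,
        mul_one_div]
      exact div_self_le_one _
    linarith
  · positivity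
  · exact le_rfl

theorem transition_row_sum {N : ℕ} (G : SimpleGraph (Fin N)) [DecidableRel G.Adj]
    (i : Fin N) : ∑ j, transition G i j = 1 := by
  have h : ∑ j ∈ Finset.univ.erase i, transition G i j
      = ∑ k ∈ G.neighborFinset i, min (1 / (G.degree i : ℝ)) (1 / (G.degree k : ℝ)) := by
    symm
    apply Finset.sum_subset_zero_on_sdiff
    · intro k hk
      rw [SimpleGraph.mem_neighborFinset] at hk
      simp [hk.ne']
    · intro k hk
      simp only [Finset.mem_sdiff, Finset.mem_erase, Finset.mem_univ, and_true,
        SimpleGraph.mem_neighborFinset] at hk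
      simp [transition, hk.2, Ne.symm hk.1]
    · intro k hk
      rw [SimpleGraph.mem_neighborFinset] at hk
      simp [transition, hk, hk.ne]
  rw [← Finset.add_sum_erase _ _ (Finset.mem_univ i), h]
  simp [transition]

/-- The (absolute) spectral gap of the transition matrix: `1 - max |lam|` over its
eigenvalues `lam ≠ 1`. -/
def spectralGap {N : ℕ} (G : SimpleGraph (Fin N)) [DecidableRel G.Adj] : ℝ :=
  1 - sSup {x : ℝ | ∃ lam ∈ spectrum ℝ (transition G), lam ≠ 1 ∧ x = |lam|}

/-- The law of the agent to which agent `i` forwards a token. -/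
def forwardLaw {N : ℕ} (G : SimpleGraph (Fin N)) [DecidableRel G.Adj] (i : Fin N) :
    PMF (Fin N) :=
  PMF.ofFintype (fun j => ENNReal.ofReal (transition G i j)) (by
    rw [← ENNReal.ofReal_sum_of_nonneg fun j _ => transition_nonneg G i j,
      transition_row_sum, ENNReal.ofReal_one])

/-- Identity of a walk: the agent that launches it and its number among the `K` walks
launched by that agent. -/
abbrev WalkId (N K : ℕ) : Type := Fin N × Fin K

/-- All random forwarding choices: `ω (k, s, i)` is the agent chosen at the
`(s + 1)`-st forwarding of the token of walk `k`, when it is agent `i` that forwards it.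
A token is forwarded for the `(s + 1)`-st time at most once, so each forwarding uses
a fresh choice. -/
abbrev Choices (N K : ℕ) : Type := WalkId N K × ℕ × Fin N → Fin N

/-- The choices are independent, and a choice made by agent `i` has law `Ψ(i, ·)`. -/
def choiceMeasure {N : ℕ} (G : SimpleGraph (Fin N)) [DecidableRel G.Adj] (K : ℕ) :
    Measure (Choices N K) :=
  Measure.infinitePi fun x => (forwardLaw G x.2.2).toMeasure

/-- Position of walk `k` after `s` steps. -/
def walk {N K : ℕ} (ω : Choices N K) (k : WalkId N K) : ℕ → Fin N
  | 0 => k.1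
  | s + 1 => ω (k, s, walk ω k s)

/-- A token: the walk it belongs to and its remaining length. -/
structure Token (N K : ℕ) where
  id : WalkId N K
  len : ℕ

/-- The feasible tokens of a list: those with non-zero remaining length. -/
def feasible {N K : ℕ} (l : List (Token N K)) : List (Token N K) :=
  l.filter fun x => decide (x.len ≠ 0)

/-- Tokens that agent `i` forwards in a slot if its queue is `q`: the first (up to) `K`. -/
def popped {N K : ℕ} (q : List (Token N K)) : List (Token N K) := q.take K

/-- The agent to which agent `i` forwards token `x`, for walks of length `L`; the token has
been forwarded `L - x.len` times before. -/
def dest {N K : ℕ} (ω : Choices N K) (L : ℕ) (i : Fin N) (x : Token N K) : Fin N :=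
  ω (x.id, L - x.len, i)

/-- Tokens that reach agent `j` in a slot which begins with the queues `q`, with their
lengths decreased by one. -/
def received {N K : ℕ} (ω : Choices N K) (L : ℕ) (q : Fin N → List (Token N K))
    (j : Fin N) : List (Token N K) :=
  (List.finRange N).flatMap fun i =>
    ((popped (q i)).filter fun x => decide (dest ω L i x = j)).map
      fun x => ⟨x.id, x.len - 1⟩

/-- `Q t i` is the queue of agent `i` at the beginning of slot `t` in an execution of
the FIFO forwarding rule in which every agent launches `K` tokens of length `L` and forwards
up to `K` tokens per slot. Tokens that enter a queue in the same slot may be put into any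
order; earlier tokens stay ahead of later ones. -/
structure IsExecution {N K : ℕ} (ω : Choices N K) (L : ℕ)
    (Q : ℕ → Fin N → List (Token N K)) : Prop where
  init : ∀ i, (Q 0 i).Perm (feasible ((List.finRange K).map fun m => ⟨(i, m), L⟩))
  step : ∀ t j, ∃ a : List (Token N K), a.Perm (feasible (received ω L (Q t) j)) ∧
    Q (t + 1) j = (Q t j).drop K ++ a

/-- Within the first `T` slots, the token of walk `k` reaches agent `j` with remaining
length zero. -/
def Sampled {N K : ℕ} (ω : Choices N K) (L : ℕ) (Q : ℕ → Fin N → List (Token N K))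
    (T : ℕ) (k : WalkId N K) (j : Fin N) : Prop :=
  ∃ t < T, (⟨k, 0⟩ : Token N K) ∈ received ω L (Q t) j

/-- Bits of the message that forwards a token: the adoption vector (`M` bits), the
decreased length in binary, and `hdr` bits of protocol information. -/
def messageBits {N K : ℕ} (M hdr : ℕ) (x : Token N K) : ℕ :=
  M + hdr + Nat.size (x.len - 1)

/-- Bits sent by agent `i` within the first `T` slots. -/
def bitsSent {N K : ℕ} (M hdr : ℕ) (Q : ℕ → Fin N → List (Token N K)) (T : ℕ)
    (i : Fin N) : ℕ :=
  ∑ t ∈ Finset.range T, ((popped (Q t i)).map (messageBits M hdr)).sum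

end MHRW

end

/-!
Three independent facts carry the proof.

*Mixing.* The transition matrix `Ψ` is symmetric and stochastic, and on a connected graph its
eigenvalue `1` belongs to the constants only. Hence all eigenvalues of `Ψ - J / N` (where
`J / N` is `uniformMatrix N`) have modulus at most `1 - Γ(Ψ)`, and
`(Ψ - J / N) ^ L = Ψ ^ L - J / N`, so the entries of `Ψ ^ L` are within `(1 - γ) ^ L` of `1 / N`
(`abs_transition_pow_sub_le`). This is at most `N ^ (-3)` as soon as `L ≥ (3 / γ) log N`.

*Load.* As `Ψ` is doubly stochastic, the mean number of walks at a given agent after a given number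
of steps is exactly `K`. The walks are independent, so Chernoff's bound shows that some such number
reaches `c K` with probability at most `N L exp (-(c - 2) K)`
(`one_sub_le_choiceMeasure_real_occupancy_lt`). If `K ≥ 1`, then `K > (h / 2) log N`, and a large
constant `c` makes this at most `N ^ (-h / 3)`.

*Queues.* The rest is deterministic. Tokens are never duplicated, so a queue never holds more tokens
than there are walks that ever visit its agent, which is at most `c K L` if the load is low.
First-in-first-out service of `K` tokens per slot then bounds each step by `c L` slots, so all walks
finish within `c L ^ 2 = O(log ^ 2 N)` slots (`IsExecution.sampled_of_occupancy_le`). An agent sends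
at most `K` messages of `O(log N)` bits in each slot (`IsExecution.bitsSent_le`).
-/

namespace MHRW

open ProbabilityTheory Matrix

/-! ### First-in-first-out queues -/

section Queues

variable {N K L : ℕ} {ω : Choices N K} {Q : ℕ → Fin N → List (Token N K)}

theorem mem_received {q : Fin N → List (Token N K)} {j : Fin N} {y : Token N K} :
    y ∈ received ω L q j ↔ ∃ i, ∃ x ∈ popped (q i), dest ω L i x = j ∧
      y = ⟨x.id, x.len - 1⟩ := by
  simp only [received, List.mem_flatMap, List.mem_finRange, true_and, List.mem_map,
    List.mem_filter, decide_eq_true_eq, and_assoc, eq_comm (a := y)]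

/-- A queued token is where its walk is: the queue position encodes the walk position. -/
theorem IsExecution.token_spec (hQ : IsExecution ω L Q) (t : ℕ) :
    ∀ i, ∀ x ∈ Q t i, x.len ≠ 0 ∧ x.len ≤ L ∧ walk ω x.id (L - x.len) = i := by
  induction t with
  | zero =>
    intro i x hx
    rw [(hQ.init i).mem_iff] at hx
    simp only [feasible, List.mem_filter, List.mem_map, decide_eq_true_eq] at hx
    obtain ⟨⟨m, -, rfl⟩, h0⟩ := hx
    simp_all [walk]
  | succ t ih =>
    intro j y hy
    obtain ⟨a, ha, h⟩ := hQ.step t j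
    rw [h, List.mem_append] at hy
    rcases hy with hy | hy
    · exact ih j y (List.mem_of_mem_drop hy)
    · rw [ha.mem_iff] at hy
      simp only [feasible, List.mem_filter, decide_eq_true_eq] at hy
      obtain ⟨hy, h0⟩ := hy
      obtain ⟨i, x, hx, hd, rfl⟩ := mem_received.1 hy
      obtain ⟨h1, h2, h3⟩ := ih i x (List.mem_of_mem_take hx)
      refine ⟨h0, by simp only; omega, ?_⟩
      have : L - (x.len - 1) = (L - x.len) + 1 := by omega
      simp only [this, walk, h3]
      exact hd

theorem sum_countP_dest (l : List (Token N K)) (d : Token N K → Fin N) (p : Token N K → Bool) :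
    ∑ j, (l.filter fun x => decide (d x = j)).countP p = l.countP p := by
  induction l with
  | nil => simp
  | cons x l ih =>
    have h : ∀ j, ((x :: l).filter fun x => decide (d x = j)).countP p
        = (l.filter fun x => decide (d x = j)).countP p
          + if d x = j then (if p x then 1 else 0) else 0 := by
      intro j
      by_cases hj : d x = j <;> simp [List.countP_cons, hj]
    simp [h, Finset.sum_add_distrib, ih, List.countP_cons]

/-- Forwarding neither duplicates nor creates tokens, so at most one token of each walk is
queued anywhere. -/
theorem IsExecution.sum_countP_le_one (hQ : IsExecution ω L Q) (k : WalkId N K) (t : ℕ) :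
    ∑ i, (Q t i).countP (fun x => decide (x.id = k)) ≤ 1 := by
  induction t with
  | zero =>
    have h : ∀ i, (Q 0 i).countP (fun x => decide (x.id = k)) ≤ if i = k.1 then 1 else 0 := by
      intro i
      rw [(hQ.init i).countP_eq]
      refine (List.filter_sublist.countP_le).trans ?_
      rw [List.countP_map]
      split_ifs with hi
      · have : ((fun x : Token N K => decide (x.id = k)) ∘ fun m : Fin K => ⟨(i, m), L⟩)
            = fun m => m == k.2 := by
          funext m
          simp [hi, Prod.ext_iff, beq_eq_decide]
        rw [this]
        exact List.nodup_iff_count_le_one.1 (List.nodup_finRange K) k.2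
      · rw [Nat.le_zero, List.countP_eq_zero]
        intro m _
        simp [Prod.ext_iff, hi]
    exact (Finset.sum_le_sum fun i _ => h i).trans (by simp)
  | succ t ih =>
    refine le_trans ?_ ih
    have h : ∀ j, (Q (t + 1) j).countP (fun x => decide (x.id = k))
        ≤ ((Q t j).drop K).countP (fun x => decide (x.id = k)) +
          ∑ i, ((popped (Q t i)).filter fun x => decide (dest ω L i x = j)).countP
            (fun x => decide (x.id = k)) := by
      intro j
      obtain ⟨a, ha, h⟩ := hQ.step t j
      rw [h, List.countP_append, ha.countP_eq]
      refine Nat.add_le_add_left ((List.filter_sublist.countP_le).trans_eq ?_) _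
      rw [received, List.countP_flatMap]
      simp only [Function.comp_def, List.countP_map]
      rw [← List.sum_ofFn, List.ofFn_eq_map]
    refine (Finset.sum_le_sum fun j _ => h j).trans ?_
    rw [Finset.sum_add_distrib, Finset.sum_comm]
    simp only [sum_countP_dest]
    rw [← Finset.sum_add_distrib]
    refine (Finset.sum_congr rfl fun i _ => ?_).le
    rw [add_comm, popped, ← List.countP_append, List.take_append_drop]

/-- Number of walks that are at agent `i` after `s` steps. -/
def occupancy (ω : Choices N K) (s : ℕ) (i : Fin N) : ℕ :=
  (Finset.univ.filter fun k : WalkId N K => walk ω k s = i).card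

theorem length_eq_sum_countP (l : List (Token N K)) :
    l.length = ∑ k : WalkId N K, l.countP (fun x => decide (x.id = k)) := by
  induction l with
  | nil => simp
  | cons x l ih => simp [List.countP_cons, Finset.sum_add_distrib, ← ih]

/-- At any time, the queue of an agent is no longer than the total number of visits of walks to
that agent. -/
theorem IsExecution.length_le (hQ : IsExecution ω L Q) (t : ℕ) (i : Fin N) :
    (Q t i).length ≤ ∑ s ∈ Finset.range L, occupancy ω s i := by
  have h : ∀ k : WalkId N K, (Q t i).countP (fun x => decide (x.id = k))
      ≤ ∑ s ∈ Finset.range L, if walk ω k s = i then 1 else 0 := by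
    intro k
    by_cases h0 : (Q t i).countP (fun x => decide (x.id = k)) = 0
    · omega
    · obtain ⟨x, hx, hk⟩ := List.countP_pos_iff.1 (Nat.pos_of_ne_zero h0)
      have hk : x.id = k := by simpa using hk
      obtain ⟨h1, h2, h3⟩ := hQ.token_spec t i x hx
      calc (Q t i).countP (fun x => decide (x.id = k))
          ≤ ∑ i, (Q t i).countP (fun x => decide (x.id = k)) :=
            Finset.single_le_sum (f := fun i => (Q t i).countP (fun x => decide (x.id = k)))
              (fun _ _ => Nat.zero_le _) (Finset.mem_univ i)
        _ ≤ 1 := hQ.sum_countP_le_one k t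
        _ = if walk ω k (L - x.len) = i then 1 else 0 := by rw [← hk, if_pos h3]
        _ ≤ _ := Finset.single_le_sum (f := fun s => if walk ω k s = i then 1 else 0)
              (fun _ _ => Nat.zero_le _) (Finset.mem_range.2 (by omega))
  rw [length_eq_sum_countP]
  refine (Finset.sum_le_sum fun k _ => h k).trans ?_
  rw [Finset.sum_comm]
  simp [occupancy]

/-- First-in-first-out service: the token at place `p < (d + 1) K` of a queue is forwarded at most
`d` slots later. -/
theorem IsExecution.exists_mem_popped (hQ : IsExecution ω L Q) {i : Fin N} {x : Token N K}
    (d : ℕ) : ∀ t p : ℕ, (Q t i)[p]? = some x → p < (d + 1) * K →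
      ∃ e ≤ d, x ∈ popped (Q (t + e) i) := by
  induction d with
  | zero =>
    intro t p hp hlt
    refine ⟨0, le_rfl, ?_⟩
    rw [zero_add, one_mul] at hlt
    exact List.mem_of_getElem? (i := p) (by rw [popped, List.getElem?_take_of_lt hlt]; exact hp)
  | succ d ih =>
    intro t p hp hlt
    by_cases hpK : p < K
    · exact ⟨0, Nat.zero_le _,
        List.mem_of_getElem? (i := p) (by rw [popped, List.getElem?_take_of_lt hpK]; exact hp)⟩
    · have hlen := (List.getElem?_eq_some_iff.1 hp).1
      obtain ⟨a, -, h⟩ := hQ.step t i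
      obtain ⟨e, he, hx⟩ := ih (t + 1) (p - K) (by
        rw [h, List.getElem?_append_left (by rw [List.length_drop]; omega), List.getElem?_drop,
          Nat.add_sub_cancel' (by omega)]
        exact hp) (by
          have : (d + 1 + 1) * K = (d + 1) * K + K := by ring
          omega)
      exact ⟨e + 1, by omega, by rwa [Nat.add_right_comm, Nat.add_assoc] at hx⟩

theorem IsExecution.exists_mem_received (hQ : IsExecution ω L Q) {D : ℕ}
    (hD : ∀ t i, (Q t i).length ≤ D * K) (k : WalkId N K) {s : ℕ} (hs : s < L) {t : ℕ}
    (ht : (⟨k, L - s⟩ : Token N K) ∈ Q t (walk ω k s)) :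
    ∃ e < D, (⟨k, L - (s + 1)⟩ : Token N K) ∈
      received ω L (Q (t + e)) (walk ω k (s + 1)) := by
  obtain ⟨p, hp⟩ := List.mem_iff_getElem?.1 ht
  have hlt := (List.getElem?_eq_some_iff.1 hp).1.trans_le (hD t _)
  obtain ⟨d, rfl⟩ : ∃ d, D = d + 1 := Nat.exists_eq_succ_of_ne_zero (by rintro rfl; simp at hlt)
  obtain ⟨e, he, hx⟩ := hQ.exists_mem_popped d t p hp hlt
  refine ⟨e, by omega, mem_received.2 ⟨_, _, hx, ?_, by simp [Nat.sub_sub]⟩⟩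
  simp only [dest, walk]
  congr 3
  omega

/-- If no queue ever takes more than `D` slots to serve, each step of a walk takes at most
`D` slots. -/
theorem IsExecution.exists_mem_queue (hQ : IsExecution ω L Q) {D : ℕ}
    (hD : ∀ t i, (Q t i).length ≤ D * K) (k : WalkId N K) (s : ℕ) (hs : s < L) :
    ∃ t ≤ s * D, (⟨k, L - s⟩ : Token N K) ∈ Q t (walk ω k s) := by
  induction s with
  | zero =>
    refine ⟨0, Nat.zero_le _, ?_⟩
    rw [(hQ.init _).mem_iff]
    simp only [feasible, List.mem_filter, List.mem_map, decide_eq_true_eq]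
    exact ⟨⟨k.2, List.mem_finRange _, rfl⟩, by omega⟩
  | succ s ih =>
    obtain ⟨t, ht, hq⟩ := ih (by omega)
    obtain ⟨e, he, hr⟩ := hQ.exists_mem_received hD k (by omega) hq
    refine ⟨t + e + 1, by rw [Nat.succ_mul]; omega, ?_⟩
    obtain ⟨a, ha, h⟩ := hQ.step (t + e) (walk ω k (s + 1))
    rw [h, List.mem_append, ha.mem_iff, feasible, List.mem_filter]
    exact Or.inr ⟨hr, by simp only [decide_eq_true_eq]; omega⟩

/-- Low occupancies force every walk to finish: if at most `c K` walks visit any agent at any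
step, every queue is served within `c L` slots, so `L` steps take at most `c L ^ 2` slots. -/
theorem IsExecution.sampled_of_occupancy_le (hQ : IsExecution ω L Q) {c T : ℕ} (hL : 0 < L)
    (hc : ∀ s < L, ∀ i, occupancy ω s i ≤ c * K) (hT : c * L ^ 2 ≤ T) (k : WalkId N K) :
    Sampled ω L Q T k (walk ω k L) := by
  have hD : ∀ t i, (Q t i).length ≤ (c * L) * K := fun t i =>
    (hQ.length_le t i).trans <|
      (Finset.sum_le_card_nsmul _ _ (c * K) fun s hs => hc s (Finset.mem_range.1 hs) i).trans_eq
        (by rw [Finset.card_range, smul_eq_mul]; ring)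
  obtain ⟨l, rfl⟩ : ∃ l, L = l + 1 := Nat.exists_eq_succ_of_ne_zero hL.ne'
  obtain ⟨t, ht, hq⟩ := hQ.exists_mem_queue hD k l (Nat.lt_succ_self l)
  obtain ⟨e, he, hr⟩ := hQ.exists_mem_received hD k (Nat.lt_succ_self l) hq
  refine ⟨t + e, lt_of_lt_of_le ?_ hT, by simpa using hr⟩
  calc t + e < l * (c * (l + 1)) + c * (l + 1) := by omega
    _ = c * (l + 1) ^ 2 := by ring

theorem IsExecution.bitsSent_le (hQ : IsExecution ω L Q) (M hdr T : ℕ) (i : Fin N) :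
    bitsSent M hdr Q T i ≤ T * (K * (M + hdr + L)) := by
  refine (Finset.sum_le_card_nsmul _ _ (K * (M + hdr + L)) fun t _ => ?_).trans_eq (by simp)
  refine (List.sum_le_card_nsmul _ (M + hdr + L) fun n hn => ?_).trans ?_
  · obtain ⟨x, hx, rfl⟩ := List.mem_map.1 hn
    obtain ⟨-, h2, -⟩ := hQ.token_spec t i x (List.mem_of_mem_take hx)
    -- A number has at most as many binary digits as its value.
    have : Nat.size (x.len - 1) ≤ x.len - 1 := Nat.size_le.2 Nat.lt_two_pow_self
    simp only [messageBits]
    omega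
  · rw [smul_eq_mul]
    exact Nat.mul_le_mul_right _ (by simp [popped])

end Queues

section Chain

variable {N : ℕ} (G : SimpleGraph (Fin N)) [DecidableRel G.Adj]

/-! ### Mixing of the Metropolis–Hastings chain -/

theorem transition_symm (i j : Fin N) : transition G i j = transition G j i := by
  unfold transition
  by_cases h : i = j
  · subst h; rfl
  · simp only [h, Ne.symm h, if_false, G.adj_comm i j, min_comm]

theorem transition_isSymm : (transition G)ᵀ = transition G := by
  ext i j; exact transition_symm G j i

theorem transition_pos_of_adj {i j : Fin N} (h : G.Adj i j) : 0 < transition G i j := by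
  have hi : 0 < G.degree i := (G.degree_pos_iff_exists_adj i).2 ⟨j, h⟩
  have hj : 0 < G.degree j := (G.degree_pos_iff_exists_adj j).2 ⟨i, h.symm⟩
  rw [transition, if_neg h.ne, if_pos h]
  positivity

/-- A harmonic vector of the chain is constant on a connected graph, because its Dirichlet form
vanishes. -/
theorem eq_of_transition_mulVec_eq (hG : G.Connected) {v : Fin N → ℝ}
    (hv : transition G *ᵥ v = v) (i j : Fin N) : v i = v j := by
  have hrow : ∀ a, ∑ b, transition G a b * v b = v a := fun a => congrFun hv a
  have h0 : ∑ a, ∑ b, transition G a b * (v a - v b) ^ 2 = 0 := by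
    have h1 : ∑ a, ∑ b, transition G a b * v a ^ 2 = ∑ a, v a ^ 2 :=
      Finset.sum_congr rfl fun a _ => by rw [← Finset.sum_mul, transition_row_sum, one_mul]
    have h2 : ∑ a, ∑ b, transition G a b * v b ^ 2 = ∑ a, v a ^ 2 := by
      rw [Finset.sum_comm]
      refine Finset.sum_congr rfl fun b _ => ?_
      simp_rw [transition_symm G _ b]
      rw [← Finset.sum_mul, transition_row_sum, one_mul]
    have h3 : ∑ a, ∑ b, v a * (transition G a b * v b) = ∑ a, v a ^ 2 :=
      Finset.sum_congr rfl fun a _ => by rw [← Finset.mul_sum, hrow, sq]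
    have h4 : ∑ a, ∑ b, transition G a b * (v a - v b) ^ 2
        = ∑ a, ∑ b, transition G a b * v a ^ 2 + ∑ a, ∑ b, transition G a b * v b ^ 2
          - 2 * ∑ a, ∑ b, v a * (transition G a b * v b) := by
      simp only [Finset.mul_sum, ← Finset.sum_add_distrib, ← Finset.sum_sub_distrib]
      exact Finset.sum_congr rfl fun a _ => Finset.sum_congr rfl fun b _ => by ring
    rw [h4, h1, h2, h3]; ring
  have hnn : ∀ a b, 0 ≤ transition G a b * (v a - v b) ^ 2 := fun a b =>
    mul_nonneg (transition_nonneg G a b) (sq_nonneg _)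
  have hadj : ∀ a b, G.Adj a b → v a = v b := by
    intro a b hab
    have h1 := (Finset.sum_eq_zero_iff_of_nonneg fun a _ =>
      Finset.sum_nonneg fun b _ => hnn a b).1 h0 a (Finset.mem_univ a)
    have h2 := (Finset.sum_eq_zero_iff_of_nonneg fun b _ => hnn a b).1 h1 b (Finset.mem_univ b)
    rcases mul_eq_zero.1 h2 with h | h
    · exact absurd h (transition_pos_of_adj G hab).ne'
    · exact sub_eq_zero.1 (pow_eq_zero_iff two_ne_zero |>.1 h)
  obtain ⟨p⟩ := hG.preconnected i j
  induction p with
  | nil => rfl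
  | cons h _ ih => exact (hadj _ _ h).trans ih

theorem spectralGap_le_one : spectralGap G ≤ 1 := by
  have : 0 ≤ sSup {x : ℝ | ∃ lam ∈ spectrum ℝ (transition G), lam ≠ 1 ∧ x = |lam|} :=
    Real.sSup_nonneg (by rintro _ ⟨lam, -, -, rfl⟩; exact abs_nonneg lam)
  rw [spectralGap]; linarith

theorem abs_le_of_mem_spectrum {lam : ℝ} (h : lam ∈ spectrum ℝ (transition G)) (h1 : lam ≠ 1) :
    |lam| ≤ 1 - spectralGap G := by
  rw [spectralGap, sub_sub_cancel]
  refine le_csSup ?_ ⟨lam, h, h1, rfl⟩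
  refine (((Matrix.finite_real_spectrum (A := transition G)).image fun x => |x|).subset ?_).bddAbove
  rintro _ ⟨mu, hm, -, rfl⟩
  exact ⟨mu, hm, rfl⟩

/-- The rank-one projection onto the constant vectors, the matrix of the uniform law. -/
noncomputable def uniformMatrix (N : ℕ) : Matrix (Fin N) (Fin N) ℝ := fun _ _ => 1 / (N : ℝ)

theorem transition_mul_uniformMatrix : transition G * uniformMatrix N = uniformMatrix N := by
  ext i j
  simp only [Matrix.mul_apply, uniformMatrix, ← Finset.sum_mul, transition_row_sum, one_mul]

theorem uniformMatrix_mul_transition : uniformMatrix N * transition G = uniformMatrix N := by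
  ext i j
  simp only [Matrix.mul_apply, uniformMatrix, ← Finset.mul_sum]
  simp_rw [transition_symm G _ j, transition_row_sum, mul_one]

theorem uniformMatrix_mul_self (hN : N ≠ 0) :
    uniformMatrix N * uniformMatrix N = uniformMatrix N := by
  ext i j
  simp [Matrix.mul_apply, uniformMatrix, hN]

theorem sub_uniformMatrix_pow (hN : N ≠ 0) (n : ℕ) :
    (transition G - uniformMatrix N) ^ (n + 1) = transition G ^ (n + 1) - uniformMatrix N := by
  have hp : ∀ n : ℕ, transition G ^ n * uniformMatrix N = uniformMatrix N := by
    intro n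
    induction n with
    | zero => simp
    | succ n ih => rw [pow_succ, mul_assoc, transition_mul_uniformMatrix, ih]
  induction n with
  | zero => simp
  | succ n ih =>
    rw [pow_succ, ih, sub_mul, mul_sub, mul_sub, hp, uniformMatrix_mul_transition,
      uniformMatrix_mul_self hN, sub_self, sub_zero, ← pow_succ]

theorem sub_uniformMatrix_isHermitian : (transition G - uniformMatrix N).IsHermitian := by
  rw [Matrix.IsHermitian, Matrix.conjTranspose_eq_transpose_of_trivial, Matrix.transpose_sub,
    transition_isSymm]
  rfl

/-- Removing the constants leaves only eigenvalues counted by the spectral gap: an eigenvector of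
`Ψ - J / N` for a non-zero eigenvalue has mean zero, so it is a non-constant eigenvector of `Ψ`. -/
theorem abs_eigenvalue_sub_uniformMatrix_le (hG : G.Connected) (hN : N ≠ 0) {lam : ℝ}
    {v : Fin N → ℝ} (hv0 : v ≠ 0) (hv : (transition G - uniformMatrix N) *ᵥ v = lam • v) :
    |lam| ≤ 1 - spectralGap G := by
  rcases eq_or_ne lam 0 with rfl | hl
  · rw [abs_zero]; linarith [spectralGap_le_one G]
  have hU : uniformMatrix N *ᵥ v = 0 := by
    have h1 : uniformMatrix N *ᵥ ((transition G - uniformMatrix N) *ᵥ v) = 0 := by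
      rw [Matrix.mulVec_mulVec, mul_sub, uniformMatrix_mul_transition, uniformMatrix_mul_self hN,
        sub_self, Matrix.zero_mulVec]
    rw [hv, Matrix.mulVec_smul] at h1
    exact (smul_eq_zero.1 h1).resolve_left hl
  have hT : transition G *ᵥ v = lam • v := by
    rw [← hv, Matrix.sub_mulVec, hU, sub_zero]
  refine abs_le_of_mem_spectrum G ?_ ?_
  · rw [← Matrix.spectrum_toLin']
    exact (Module.End.hasEigenvalue_of_hasEigenvector (x := v)
      ⟨Module.End.mem_eigenspace_iff.2 (by rw [Matrix.toLin'_apply, hT]), hv0⟩).mem_spectrum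
  · rintro rfl
    rw [one_smul] at hT
    apply hv0
    funext i
    have h := congrFun hU i
    simp only [Matrix.mulVec, dotProduct, uniformMatrix] at h
    simp_rw [eq_of_transition_mulVec_eq G hG hT _ i] at h
    simpa [hN] using h

/-- Entries of powers of a symmetric matrix are bounded by powers of its spectral radius. -/
theorem abs_pow_apply_le {A : Matrix (Fin N) (Fin N) ℝ} (hA : A.IsHermitian) {r : ℝ}
    (hr : ∀ a, |hA.eigenvalues a| ≤ r) (n : ℕ) (i j : Fin N) : |(A ^ n) i j| ≤ r ^ n := by
  have hr0 : 0 ≤ r := (abs_nonneg _).trans (hr i)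
  set U : Matrix (Fin N) (Fin N) ℝ := (hA.eigenvectorUnitary : Matrix (Fin N) (Fin N) ℝ) with hU
  have hUU : U * star U = 1 := Unitary.coe_mul_star_self _
  have hpow : A ^ n = U * Matrix.diagonal (fun a => hA.eigenvalues a ^ n) * star U := by
    have h := congrArg (· ^ n) hA.spectral_theorem
    simp only [← map_pow, Matrix.diagonal_pow] at h
    rw [h, Unitary.conjStarAlgAut_apply]
    rfl
  have hrow : ∀ i, ∑ a, U i a ^ 2 = 1 := by
    intro i
    have h := congrFun (congrFun hUU i) i
    rw [Matrix.mul_apply, Matrix.one_apply_eq] at h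
    rw [← h]
    exact Finset.sum_congr rfl fun a _ => by simp [Matrix.star_apply, sq]
  have hij : (A ^ n) i j = ∑ a, U i a * U j a * hA.eigenvalues a ^ n := by
    rw [hpow, Matrix.mul_apply]
    exact Finset.sum_congr rfl fun a _ => by
      rw [Matrix.mul_diagonal, Matrix.star_apply, star_trivial]; ring
  rw [hij]
  calc |∑ a, U i a * U j a * hA.eigenvalues a ^ n|
      ≤ ∑ a, |U i a * U j a * hA.eigenvalues a ^ n| := Finset.abs_sum_le_sum_abs _ _
    _ ≤ ∑ a, (U i a ^ 2 + U j a ^ 2) / 2 * r ^ n := by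
        refine Finset.sum_le_sum fun a _ => ?_
        rw [abs_mul, abs_pow]
        refine mul_le_mul ?_ (pow_le_pow_left₀ (abs_nonneg _) (hr a) n) (by positivity)
          (by positivity)
        rw [abs_le]
        constructor <;> nlinarith [sq_nonneg (U i a + U j a), sq_nonneg (U i a - U j a)]
    _ = r ^ n := by
        rw [← Finset.sum_mul, ← Finset.sum_div, Finset.sum_add_distrib, hrow, hrow]; ring

/-- Geometric convergence of the chain to the uniform law. -/
theorem abs_transition_pow_sub_le (hG : G.Connected) {L : ℕ} (hL : 0 < L) (i j : Fin N) :
    |(transition G ^ L) i j - 1 / (N : ℝ)| ≤ (1 - spectralGap G) ^ L := by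
  have hN : N ≠ 0 := fun h => (h ▸ i).elim0
  obtain ⟨n, rfl⟩ := Nat.exists_eq_succ_of_ne_zero hL.ne'
  have hA := sub_uniformMatrix_isHermitian G
  have h := abs_pow_apply_le hA (r := 1 - spectralGap G) (fun a =>
    abs_eigenvalue_sub_uniformMatrix_le G hG hN
      (v := (hA.eigenvectorBasis a).ofLp) (fun h0 =>
        (hA.eigenvectorBasis.orthonormal.ne_zero a) (by ext b; exact congrFun h0 b))
      (hA.mulVec_eigenvectorBasis a)) (n + 1) i j
  rwa [sub_uniformMatrix_pow G hN] at h

variable {K : ℕ}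

/-! ### The law of the walks -/

instance : IsProbabilityMeasure (choiceMeasure G K) := by
  unfold choiceMeasure; infer_instance

theorem walk_congr {ω ω' : Choices N K} {k : WalkId N K} {s : ℕ}
    (h : ∀ r < s, ∀ i, ω (k, r, i) = ω' (k, r, i)) : walk ω k s = walk ω' k s := by
  induction s with
  | zero => rfl
  | succ s ih =>
    rw [walk, walk, ih fun r hr => h r (by omega)]
    exact h s (Nat.lt_succ_self s) _

/-- The first `s` steps of walk `k` as a function of the finitely many choices they can use. -/
theorem exists_walk_eq_comp (k : WalkId N K) (s : ℕ) :
    ∃ φ : (({k} ×ˢ (Finset.range s ×ˢ Finset.univ) : Finset (WalkId N K × ℕ × Fin N)) → Fin N) →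
      Fin N, Measurable φ ∧ ∀ ω : Choices N K, walk ω k s = φ fun x => ω x := by
  classical
  refine ⟨fun v => walk (fun x => if h : x ∈ _ then v ⟨x, h⟩ else k.1) k s,
    Measurable.of_discrete, fun ω => walk_congr fun r hr i => ?_⟩
  rw [dif_pos (by simp [hr])]

@[fun_prop]
theorem measurable_walk (k : WalkId N K) (s : ℕ) :
    Measurable fun ω : Choices N K => walk ω k s := by
  obtain ⟨φ, hφ, h⟩ := exists_walk_eq_comp k s
  simp_rw [h]
  exact hφ.comp (by fun_prop)

theorem measurableSet_walk_eq (k : WalkId N K) (s : ℕ) (i : Fin N) :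
    MeasurableSet {ω : Choices N K | walk ω k s = i} :=
  measurable_walk k s (measurableSet_singleton i)

theorem choiceMeasure_real_eval (x : WalkId N K × ℕ × Fin N) (j : Fin N) :
    (choiceMeasure G K).real {ω | ω x = j} = transition G x.2.2 j := by
  have h : (choiceMeasure G K).map (fun ω => ω x) = (forwardLaw G x.2.2).toMeasure :=
    Measure.infinitePi_map_eval _ x
  have h2 : {ω : Choices N K | ω x = j} = (fun ω => ω x) ⁻¹' {j} := rfl
  rw [h2, measureReal_def, ← Measure.map_apply (by fun_prop) (measurableSet_singleton j), h,
    PMF.toMeasure_apply_singleton _ _ (measurableSet_singleton j), forwardLaw,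
    PMF.ofFintype_apply, ENNReal.toReal_ofReal (transition_nonneg G _ _)]

theorem iIndepFun_choices :
    iIndepFun (fun x (ω : Choices N K) => ω x) (choiceMeasure G K) :=
  iIndepFun_infinitePi (X := fun _ y => y) fun _ => measurable_id

/-- Each step uses fresh choices, so a walk is a Markov chain with transition matrix `Ψ`. -/
theorem choiceMeasure_real_walk_eq (k : WalkId N K) (s : ℕ) (j : Fin N) :
    (choiceMeasure G K).real {ω | walk ω k s = j} = (transition G ^ s) k.1 j := by
  induction s generalizing j with
  | zero =>
    by_cases h : k.1 = j <;> simp [walk, h]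
  | succ s ih =>
    have hunion : {ω : Choices N K | walk ω k (s + 1) = j}
        = ⋃ i, {ω | walk ω k s = i} ∩ {ω | ω (k, s, i) = j} := by
      ext ω; simp [walk]
    have hind : ∀ i, (choiceMeasure G K).real ({ω | walk ω k s = i} ∩ {ω | ω (k, s, i) = j})
        = (transition G ^ s) k.1 i * transition G i j := by
      intro i
      obtain ⟨φ, hφ, h⟩ := exists_walk_eq_comp k s
      have hI := (iIndepFun_choices G (K := K)).indepFun_finset
        ({k} ×ˢ (Finset.range s ×ˢ Finset.univ)) {(k, s, i)} (by simp)
        (fun x => measurable_pi_apply x)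
      have hI2 := hI.comp hφ
        (measurable_pi_apply (⟨(k, s, i), Finset.mem_singleton_self _⟩ :
          ({(k, s, i)} : Finset (WalkId N K × ℕ × Fin N))))
      have h3 := hI2.measure_inter_preimage_eq_mul {i} {j} (measurableSet_singleton i)
        (measurableSet_singleton j)
      have e1 : {ω : Choices N K | walk ω k s = i}
          = (φ ∘ fun a x => a x) ⁻¹' {i} := by ext ω; simp [h]
      rw [← ih i, ← choiceMeasure_real_eval G (K := K) (k, s, i) j, measureReal_def,
        measureReal_def, measureReal_def, ← ENNReal.toReal_mul, e1]
      exact congrArg ENNReal.toReal h3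
    rw [hunion, measureReal_iUnion_fintype, pow_succ, Matrix.mul_apply]
    · exact Finset.sum_congr rfl fun i _ => hind i
    · intro a b hab
      refine Set.disjoint_left.2 ?_
      rintro ω ⟨h1, -⟩ ⟨h2, -⟩
      exact hab (h1.symm.trans h2)
    · exact fun i => (measurableSet_walk_eq k s i).inter
        (measurableSet_eq_fun (measurable_pi_apply (k, s, i)) measurable_const)

/-- Different walks use disjoint sets of choices. -/
theorem iIndepFun_walk (s : ℕ) :
    iIndepFun (fun (k : WalkId N K) (ω : Choices N K) => walk ω k s) (choiceMeasure G K) := by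
  have hrows : iIndepFun (fun (k : WalkId N K) (ω : Choices N K) (p : ℕ × Fin N) => ω (k, p))
      (choiceMeasure G K) := by
    rw [iIndepFun_iff_map_fun_eq_infinitePi_map (by fun_prop)]
    have h1 := Measure.infinitePi_map_curry (ι := WalkId N K) (κ := ℕ × Fin N)
      (μ := fun _ p => (forwardLaw G p.2).toMeasure)
    have h2 : ∀ k : WalkId N K, (choiceMeasure G K).map (fun ω (p : ℕ × Fin N) => ω (k, p))
        = Measure.infinitePi fun p => (forwardLaw G p.2).toMeasure := fun k =>
      Measure.map_infinitePi_infinitePi_of_inj (f := fun p : ℕ × Fin N => (k, p))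
        (Prod.mk_right_injective k)
    simp_rw [h2]
    exact h1
  have h := hrows.comp (fun k u => walk (fun x => u x.2) k s) fun k =>
    (measurable_walk k s).comp (by fun_prop)
  convert h using 3 with k ω
  exact walk_congr fun _ _ _ => rfl

/-- The uniform law is stationary, so on average `K` walks are at any given agent. -/
theorem sum_choiceMeasure_real_walk_eq (s : ℕ) (i : Fin N) :
    ∑ k : WalkId N K, (choiceMeasure G K).real {ω | walk ω k s = i} = K := by
  have hT : ∀ s, (transition G ^ s)ᵀ = transition G ^ s := fun s => by
    rw [Matrix.transpose_pow, transition_isSymm]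
  have hrow : ∀ s a, ∑ b, (transition G ^ s) a b = 1 := by
    intro s
    induction s with
    | zero => intro a; simp [Matrix.one_apply]
    | succ s ih =>
      intro a
      simp_rw [pow_succ', Matrix.mul_apply]
      rw [Finset.sum_comm]
      simp_rw [← Finset.mul_sum, ih, mul_one, transition_row_sum]
  simp_rw [choiceMeasure_real_walk_eq]
  rw [Fintype.sum_prod_type]
  have : ∀ a, (transition G ^ s) a i = (transition G ^ s) i a := fun a =>
    congrFun (congrFun (hT s) i) a
  simp [← Finset.mul_sum, this, hrow]

/-! ### Concentration of the load -/

/-- Chernoff's bound at exponent `1`, for a sum of independent indicators of mean `K`. -/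
theorem choiceMeasure_real_le_occupancy (s : ℕ) (i : Fin N) (c : ℝ) :
    (choiceMeasure G K).real {ω | c * K ≤ occupancy ω s i} ≤ Real.exp (-((c - 2) * K)) := by
  classical
  set X : WalkId N K → Choices N K → ℝ := fun k ω => if walk ω k s = i then 1 else 0 with hX
  have hXind : ∀ k, X k = Set.indicator {ω | walk ω k s = i} 1 := by
    intro k; ext ω; simp [hX, Set.indicator_apply]
  have hXm : ∀ k, Measurable (X k) := fun k => by
    rw [hXind]; exact measurable_one.indicator (measurableSet_walk_eq k s i)
  have hindep : iIndepFun X (choiceMeasure G K) :=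
    (iIndepFun_walk G s).comp (fun _ a => if a = i then (1 : ℝ) else 0)
      fun _ => Measurable.of_discrete
  have hocc : ∀ ω, (∑ k, X k) ω = (occupancy ω s i : ℝ) := by
    intro ω; simp [hX, occupancy, Finset.sum_apply]
  have hmgf : ∀ k, mgf (X k) (choiceMeasure G K) 1
      ≤ Real.exp (2 * (choiceMeasure G K).real {ω | walk ω k s = i}) := by
    intro k
    have h1 : ∀ ω, Real.exp (1 * X k ω)
        = 1 + Set.indicator {ω | walk ω k s = i} (fun _ => Real.exp 1 - 1) ω := by
      intro ω
      by_cases h : walk ω k s = i <;> simp [hX, h]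
    have h2 : mgf (X k) (choiceMeasure G K) 1
        = 1 + (choiceMeasure G K).real {ω | walk ω k s = i} * (Real.exp 1 - 1) := by
      rw [mgf]
      simp_rw [h1]
      rw [integral_add (integrable_const _)
        ((integrable_const _).indicator (measurableSet_walk_eq k s i)),
        integral_indicator_const _ (measurableSet_walk_eq k s i)]
      simp
    rw [h2]
    refine le_trans ?_ (Real.add_one_le_exp _)
    have := Real.exp_one_lt_d9
    nlinarith [measureReal_nonneg (μ := choiceMeasure G K) (s := {ω | walk ω k s = i})]
  have hint : Integrable (fun ω => Real.exp (1 * (∑ k, X k) ω)) (choiceMeasure G K) := by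
    refine Integrable.of_bound (C := Real.exp (Fintype.card (WalkId N K))) ?_ ?_
    · simp_rw [Finset.sum_apply]
      exact (Real.measurable_exp.comp
        ((Finset.measurable_sum _ fun k _ => hXm k).const_mul 1)).aestronglyMeasurable
    · refine Filter.Eventually.of_forall fun ω => ?_
      rw [Real.norm_eq_abs, Real.abs_exp, one_mul, hocc, Real.exp_le_exp]
      exact_mod_cast Finset.card_le_univ _
  have hch := measure_ge_le_exp_mul_mgf (X := ∑ k, X k) (c * K) zero_le_one hint
  simp_rw [hocc] at hch
  refine hch.trans ?_
  rw [hindep.mgf_sum hXm]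
  calc Real.exp (-1 * (c * K)) * ∏ k, mgf (X k) (choiceMeasure G K) 1
      ≤ Real.exp (-1 * (c * K)) *
        ∏ k, Real.exp (2 * (choiceMeasure G K).real {ω | walk ω k s = i}) := by
        gcongr with k
        · exact fun k _ => mgf_nonneg
        · exact hmgf k
    _ = Real.exp (-((c - 2) * K)) := by
        rw [← Real.exp_sum, ← Finset.mul_sum, sum_choiceMeasure_real_walk_eq, ← Real.exp_add]
        congr 1; ring

/-- With high probability no agent is ever overloaded. -/
theorem one_sub_le_choiceMeasure_real_occupancy_lt (L : ℕ) (c : ℝ) :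
    1 - N * L * Real.exp (-((c - 2) * K)) ≤
      (choiceMeasure G K).real {ω | ∀ s < L, ∀ i, (occupancy ω s i : ℝ) < c * K} := by
  set E : Set (Choices N K) :=
    ⋃ x : Fin L × Fin N, {ω | c * K ≤ (occupancy ω x.1 x.2 : ℝ)} with hE
  have hm : MeasurableSet E := by
    refine MeasurableSet.iUnion fun x => measurableSet_le measurable_const ?_
    have : (fun ω : Choices N K => (occupancy ω x.1 x.2 : ℝ))
        = fun ω => ∑ k, Set.indicator {ω | walk ω k x.1 = x.2} (fun _ => (1 : ℝ)) ω := by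
      funext ω; simp [occupancy, Set.indicator_apply]
    rw [this]
    exact Finset.measurable_sum _ fun k _ =>
      measurable_const.indicator (measurableSet_walk_eq k _ _)
  have hc : {ω : Choices N K | ∀ s < L, ∀ i, (occupancy ω s i : ℝ) < c * K} = Eᶜ := by
    ext ω
    simp [hE, Fin.forall_iff]
  rw [hc, probReal_compl_eq_one_sub hm]
  have : (choiceMeasure G K).real E ≤ N * L * Real.exp (-((c - 2) * K)) := by
    refine (measureReal_iUnion_fintype_le _).trans ?_
    refine (Finset.sum_le_card_nsmul _ _ _ fun x _ =>
      choiceMeasure_real_le_occupancy G x.1 x.2 c).trans_eq ?_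
    simp [nsmul_eq_mul]; ring
  linarith

end Chain

/-! ### Choice of constants -/

theorem three_le_of_not_isBipartite {N : ℕ} {G : SimpleGraph (Fin N)}
    (hb : ¬ G.IsBipartite) : 3 ≤ N := by
  by_contra hN
  apply hb
  have h := G.colorable_of_fintype
  rw [Fintype.card_fin] at h
  exact h.mono (by omega)

theorem one_lt_log_natCast {N : ℕ} (hN : 3 ≤ N) : 1 < Real.log N := by
  rw [Real.lt_log_iff_exp_lt (by positivity)]
  have h1 := Real.exp_one_lt_d9
  have h2 : (3 : ℝ) ≤ N := by exact_mod_cast hN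
  linarith

theorem exp_neg_mul_log_natCast {N : ℕ} (hN : 3 ≤ N) (a : ℝ) :
    Real.exp (-(a * Real.log N)) = (N : ℝ) ^ (-a) := by
  rw [Real.rpow_def_of_pos (by positivity)]
  congr 1; ring

/-- Walks of length at least `3 / γ * log N` have nearly uniform endpoints. -/
theorem choiceMeasure_real_walk_mem_Icc {N : ℕ} (G : SimpleGraph (Fin N)) [DecidableRel G.Adj]
    (hG : G.Connected) (hN : 3 ≤ N) {γ : ℝ} (hγ : 0 < γ) (hgap : γ ≤ spectralGap G) {K L : ℕ}
    (hL : 3 / γ * Real.log N ≤ L) (k : WalkId N K) (j : Fin N) :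
    (choiceMeasure G K).real {ω | walk ω k L = j} ∈
      Set.Icc (1 / (N : ℝ) - 1 / (N : ℝ) ^ 3) (1 / (N : ℝ) + 1 / (N : ℝ) ^ 3) := by
  have hlog := one_lt_log_natCast hN
  have hL0 : 0 < L := by
    have : (0 : ℝ) < L := lt_of_lt_of_le (by positivity) hL
    exact_mod_cast this
  have hγL : 3 * Real.log N ≤ γ * L := by
    have := mul_le_mul_of_nonneg_left hL hγ.le
    rwa [← mul_assoc, mul_div_cancel₀ _ hγ.ne'] at this
  have h1 : (1 - spectralGap G) ^ L ≤ 1 / (N : ℝ) ^ 3 :=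
    calc (1 - spectralGap G) ^ L ≤ Real.exp (-γ) ^ L :=
          pow_le_pow_left₀ (by linarith [spectralGap_le_one G])
            ((sub_le_sub_left hgap 1).trans (by linarith [Real.add_one_le_exp (-γ)])) L
      _ = Real.exp (-(γ * L)) := by rw [← Real.exp_nat_mul]; congr 1; ring
      _ ≤ Real.exp (-(3 * Real.log N)) := Real.exp_le_exp.2 (by linarith)
      _ = 1 / (N : ℝ) ^ 3 := by
          rw [exp_neg_mul_log_natCast hN, Real.rpow_neg (by positivity), one_div]
          norm_cast
  rw [choiceMeasure_real_walk_eq, Set.mem_Icc]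
  have h2 := abs_le.1 ((abs_transition_pow_sub_le G hG hL0 k.1 j).trans h1)
  constructor <;> linarith [h2.1, h2.2]

end MHRW

theorem lemma1 (γ : ℝ) (hγ : 0 < γ) :
    ∃ A : ℝ, 0 < A ∧ ∀ (h : ℝ), 0 < h → ∀ (B b : ℝ) (M : ℕ),
    ∃ C₁ C₂ : ℝ, 0 < C₁ ∧ 0 < C₂ ∧
      ∀ (g : ℕ → ℝ) (N : ℕ) (G : SimpleGraph (Fin N)) [DecidableRel G.Adj],
        G.Connected → ¬ G.IsBipartite → γ ≤ MHRW.spectralGap G →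
        Real.log N < g N →
        ∀ K : ℕ, |(K : ℝ) - h * g N| < 1 →
        ∀ L : ℕ, A * Real.log N ≤ L → (L : ℝ) ≤ B * Real.log N →
        ∀ hdr : ℕ, (hdr : ℝ) ≤ b * Real.log N →
          (∀ (k : MHRW.WalkId N K) (j : Fin N),
            (MHRW.choiceMeasure G K).real {ω | MHRW.walk ω k L = j} ∈
              Set.Icc (1 / (N : ℝ) - 1 / (N : ℝ) ^ 3) (1 / (N : ℝ) + 1 / (N : ℝ) ^ 3)) ∧
          1 - (N : ℝ) ^ (-(h / 3)) ≤
            (MHRW.choiceMeasure G K).real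
              {ω | ∀ Q : ℕ → Fin N → List (MHRW.Token N K), MHRW.IsExecution ω L Q →
                ∀ k : MHRW.WalkId N K,
                  MHRW.Sampled ω L Q ⌊C₁ * Real.log N ^ 2⌋₊ k (MHRW.walk ω k L)} ∧
          ∀ (ω : MHRW.Choices N K) (Q : ℕ → Fin N → List (MHRW.Token N K)),
            MHRW.IsExecution ω L Q → ∀ i : Fin N,
              (MHRW.bitsSent M hdr Q ⌊C₁ * Real.log N ^ 2⌋₊ i : ℝ) ≤
                C₂ * g N * Real.log N ^ 3 := by
  refine ⟨3 / γ, by positivity, fun h hh B b M => ?_⟩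
  -- A load of `c K` is exceeded somewhere with probability at most `N L exp (-(c - 2) K)`, where
  -- `K > h / 2 * log N` (unless `K = 0`) and `L ≤ N ^ B`.
  obtain ⟨c, hc⟩ := exists_nat_ge (2 + 2 / h * (h / 3 + 1 + |B|))
  have hc' : h / 3 + 1 + |B| ≤ (c - 2) * (h / 2) := by
    have h1 : 2 / h * (h / 3 + 1 + |B|) * (h / 2) ≤ (c - 2) * (h / 2) :=
      mul_le_mul_of_nonneg_right (by linarith) (by positivity)
    have h2 : 2 / h * (h / 3 + 1 + |B|) * (h / 2) = h / 3 + 1 + |B| := by field_simp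
    linarith
  have hc2 : (0 : ℝ) ≤ c - 2 := by
    have : 0 ≤ 2 / h * (h / 3 + 1 + |B|) := by positivity
    linarith
  refine ⟨c * B ^ 2 + 1, (c * B ^ 2 + 1) * ((h + 1) * (M + |b| + |B| + 1)), by positivity,
    by positivity, ?_⟩
  intro g N G _ hG hbip hgap hg K hK L hAL hLB hdr hhdr
  have hN := MHRW.three_le_of_not_isBipartite hbip
  have hlog := MHRW.one_lt_log_natCast hN
  have hL0 : 0 < L := by
    have : (0 : ℝ) < L := lt_of_lt_of_le (by positivity) hAL
    exact_mod_cast this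
  refine ⟨MHRW.choiceMeasure_real_walk_mem_Icc G hG hN hγ hgap hAL, ?_, ?_⟩
  · rcases Nat.eq_zero_or_pos K with rfl | hK0
    · have : {ω | ∀ Q : ℕ → Fin N → List (MHRW.Token N 0), MHRW.IsExecution ω L Q →
          ∀ k : MHRW.WalkId N 0, MHRW.Sampled ω L Q
            ⌊(c * B ^ 2 + 1) * Real.log N ^ 2⌋₊ k (MHRW.walk ω k L)} = Set.univ :=
        Set.eq_univ_of_forall fun ω Q _ k => k.2.elim0
      rw [this, probReal_univ]
      linarith [Real.rpow_nonneg (Nat.cast_nonneg (α := ℝ) N) (-(h / 3))]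
    · have hT : c * L ^ 2 ≤ ⌊(c * B ^ 2 + 1) * Real.log N ^ 2⌋₊ := by
        apply Nat.le_floor
        push_cast
        calc (c : ℝ) * (L : ℝ) ^ 2 ≤ c * (B * Real.log N) ^ 2 := by gcongr
          _ ≤ (c * B ^ 2 + 1) * Real.log N ^ 2 := by nlinarith [sq_nonneg (Real.log N)]
      have hsub : {ω : MHRW.Choices N K | ∀ s < L, ∀ i, (MHRW.occupancy ω s i : ℝ) < c * K} ⊆
          {ω | ∀ Q : ℕ → Fin N → List (MHRW.Token N K), MHRW.IsExecution ω L Q →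
            ∀ k : MHRW.WalkId N K, MHRW.Sampled ω L Q
              ⌊(c * B ^ 2 + 1) * Real.log N ^ 2⌋₊ k (MHRW.walk ω k L)} :=
        fun ω hω Q hQ k => hQ.sampled_of_occupancy_le hL0
          (fun s hs i => by exact_mod_cast (hω s hs i).le) hT k
      refine le_trans ?_ (measureReal_mono hsub)
      refine le_trans ?_ (MHRW.one_sub_le_choiceMeasure_real_occupancy_lt G L c)
      refine sub_le_sub_left ?_ 1
      have hK2 : h / 2 * Real.log N ≤ K := by
        have h1 : (1 : ℝ) ≤ K := by exact_mod_cast hK0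
        have h2 := (abs_lt.1 hK).1
        have h3 := mul_lt_mul_of_pos_left hg hh
        linarith
      have hLN : (L : ℝ) ≤ (N : ℝ) ^ |B| := by
        calc (L : ℝ) ≤ |B| * Real.log N :=
              hLB.trans (mul_le_mul_of_nonneg_right (le_abs_self B) (by linarith))
          _ ≤ Real.exp (|B| * Real.log N) := by
              linarith [Real.add_one_le_exp (|B| * Real.log N)]
          _ = (N : ℝ) ^ |B| := by
              rw [Real.rpow_def_of_pos (by positivity), mul_comm]
      have hexp : Real.exp (-((c - 2) * K)) ≤ (N : ℝ) ^ (-(h / 3 + 1 + |B|)) := by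
        rw [← MHRW.exp_neg_mul_log_natCast hN, Real.exp_le_exp, neg_le_neg_iff]
        calc (h / 3 + 1 + |B|) * Real.log N ≤ (c - 2) * (h / 2) * Real.log N := by gcongr
          _ = (c - 2) * (h / 2 * Real.log N) := by ring
          _ ≤ (c - 2) * K := by gcongr
      have hNpos : (0 : ℝ) < N := by positivity
      calc (N : ℝ) * L * Real.exp (-((c - 2) * K))
          ≤ (N : ℝ) ^ (1 : ℝ) * (N : ℝ) ^ |B| * (N : ℝ) ^ (-(h / 3 + 1 + |B|)) := by
            rw [Real.rpow_one]; gcongr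
        _ = (N : ℝ) ^ (-(h / 3)) := by
            rw [← Real.rpow_add hNpos, ← Real.rpow_add hNpos]
            congr 1; ring
  · intro ω Q hQ i
    have hKg : (K : ℝ) ≤ (h + 1) * g N := by
      have := (abs_lt.1 hK).2
      nlinarith
    have hbits : (M : ℝ) + hdr + L ≤ (M + |b| + |B| + 1) * Real.log N := by
      have h1 : b * Real.log N ≤ |b| * Real.log N := by gcongr; exact le_abs_self b
      have h2 : B * Real.log N ≤ |B| * Real.log N := by gcongr; exact le_abs_self B
      have h3 : (M : ℝ) ≤ M * Real.log N := le_mul_of_one_le_right (by positivity) hlog.le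
      linarith
    calc (MHRW.bitsSent M hdr Q ⌊(c * B ^ 2 + 1) * Real.log N ^ 2⌋₊ i : ℝ)
        ≤ (⌊(c * B ^ 2 + 1) * Real.log N ^ 2⌋₊ : ℝ) * (K * (M + hdr + L)) := by
          exact_mod_cast hQ.bitsSent_le M hdr _ i
      _ ≤ ((c * B ^ 2 + 1) * Real.log N ^ 2) *
          (((h + 1) * g N) * ((M + |b| + |B| + 1) * Real.log N)) := by
          have hg0 : 0 < g N := by linarith
          gcongr
          exact Nat.floor_le (by positivity)
      _ = _ := by ring
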